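/- Let $Z=\mathrm{SU}(3)/\mathrm{T}^2$, where $\mathrm{T}^2$ is the diagonal maximal torus. An element of $\mathrm{SU}(3)$ is regarded as a special unitary frame $(\mathbf e_1,\mathbf e_2,\mathbf e_3)$ of $\mathbb C^3$ (its columns), and its class $[\mathbf e_1,\mathbf e_2,\mathbf e_3]\in Z$ as the complete flag $(\mathrm{span}(\mathbf e_1),\mathrm{span}(\mathbf e_1,\mathbf e_2))$. Let $\gamma=g^{-1}dg$, with entries $\gamma_{jk}=\langle d\mathbf e_k,\mathbf e_j\rangle$ (the Hermitian product being complex linear in its first argument), be the Maurer–Cartan form, and put $\eta_1=\gamma_{32}$, $\eta_2=\gamma_{13}$, $\eta_3=\gamma_{21}$. The nearly Kähler almost complex structure $J$ on $Z$ is the one for which a complex-valued $1$-form on $Z$ is of type $(1,0)$ if and only if its pullback to $\mathrm{SU}(3)$ lies pointwise in the span of $\eta_1,\eta_2,\eta_3$. Let $\Sigma$ be a connected Riemann surface and let $f:\Sigma\to Z$ be an immersed $J$-holomorphic curve, i.e. a smooth immersion that pulls $(1,0)$-forms back to $(1,0)$-forms. Pull $\eta_1,\eta_2,\eta_3$ back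 to $\Sigma$ by local smooth lifts of $f$ to $\mathrm{SU}(3)$. The product $C=\eta_1\eta_2\eta_3$ does not depend on the lift and is a cubic form on $\Sigma$; if $\sigma$ is a local unitary coframe and $\eta_i=A_i\sigma$, then $C=A_1A_2A_3\,\sigma^3$. The curve $f$ is called superholomorphic if $C\equiv 0$. For a non-constant holomorphic curve $h:S\to\mathbb{CP}^2$ on a connected Riemann surface $S$ (branch points allowed), a Frenet frame of $h$ is a smooth map $F=[\mathbf e_1,\mathbf e_2,\mathbf e_3]:S\to Z$ such that $h=\mathrm{span}(\mathbf e_1)$ and $d\mathbf e_1$ takes values in $\mathrm{span}(\mathbf e_1,\mathbf e_2)$ for all local smooth lifts. Given $F$, define three maps $f_i:S\to Z$ by $$f_1=(\mathrm{span}(\mathbf e_1),\mathrm{span}(\mathbf e_1,\mathbf e_2)),\quad f_2=(\mathrm{span}(\mathbf e_2),\mathrm{span}(\mathbf e_2,\mathbf e_3)),\quad f_3=(\mathrm{span}(\mathbf e_3),\mathrm{span}(\mathbf e_3,\mathbf e_1)).$$ **Theorem.** Let $f:\Sigma\to Z$ be a superholomorphic curve. Then there are a non-constant holomorphic curve $h:\Sigma\to\mathbb{CP}^2$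 with a Frenet frame $F$, and an $i\in\{1,2,3\}$, such that $f=f_i$, where $f_i$ is the $i$-th lift of $h$ determined by $F$. In particular $f(\Sigma)=f_i(S)$ with $S=\Sigma$. -/

import Mathlib

open scoped Manifold ContDiff LinearAlgebra.Projectivization

namespace FlagCurves

/-- `SU(3)`. An element is read as the special unitary frame `(e₁, e₂, e₃)` of `ℂ³` formed by its
columns, which are indexed here by `0, 1, 2 : Fin 3`. -/
abbrev SU3 : Type := Matrix.specialUnitaryGroup (Fin 3) ℂ

/-- The maximal torus `T²` of diagonal matrices in `SU(3)`. -/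
def T2 : Subgroup SU3 where
  carrier := {g | (g : Matrix (Fin 3) (Fin 3) ℂ).IsDiag}
  one_mem' := Matrix.isDiag_one
  mul_mem' {a b} ha hb := by
    have ha' : (a : Matrix (Fin 3) (Fin 3) ℂ).IsDiag := ha
    have hb' : (b : Matrix (Fin 3) (Fin 3) ℂ).IsDiag := hb
    change ((a : Matrix (Fin 3) (Fin 3) ℂ) * (b : Matrix (Fin 3) (Fin 3) ℂ)).IsDiag
    rw [← ha'.diagonal_diag, ← hb'.diagonal_diag, Matrix.diagonal_mul_diagonal]
    exact Matrix.isDiag_diagonal _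
  inv_mem' {a} ha := by
    have ha' : (a : Matrix (Fin 3) (Fin 3) ℂ).IsDiag := ha
    exact ha'.conjTranspose

/-- The flag manifold `Z = SU(3)/T²`. The class of `(e₁, e₂, e₃)` is the complete flag
`(span e₁, span (e₁, e₂))`. -/
abbrev Flag : Type := SU3 ⧸ T2

/-- The coset projection `π : SU(3) → SU(3)/T²`. -/
def proj (g : SU3) : Flag := QuotientGroup.mk g

/-- The complex projective plane `ℂP²`. -/
abbrev CP2 : Type := ℙ ℂ (Fin 3 → ℂ)

/-- The vector `e_{j+1}` of a frame. -/
def col (g : SU3) (j : Fin 3) : Fin 3 → ℂ := fun a => (g : Matrix (Fin 3) (Fin 3) ℂ) a j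

theorem col_ne_zero (g : SU3) (j : Fin 3) : col g j ≠ 0 := by
  intro h
  have hdet : (g : Matrix (Fin 3) (Fin 3) ℂ).det = 1 :=
    (Matrix.mem_specialUnitaryGroup_iff.1 g.2).2
  rw [Matrix.det_eq_zero_of_column_eq_zero j (fun a => congrFun h a)] at hdet
  exact zero_ne_one hdet

theorem rel_iff (g g' : SU3) :
    QuotientGroup.leftRel T2 g g' ↔ ∃ t ∈ T2, g' = g * t := by
  rw [QuotientGroup.leftRel_apply]
  constructor
  · intro h
    exact ⟨_, h, by group⟩
  · rintro ⟨t, ht, rfl⟩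
    simpa using ht

theorem col_mul_torus (g t : SU3) (ht : t ∈ T2) (j : Fin 3) :
    col (g * t) j = (t : Matrix (Fin 3) (Fin 3) ℂ) j j • col g j := by
  have ht' : (t : Matrix (Fin 3) (Fin 3) ℂ).IsDiag := ht
  funext a
  change ((g : Matrix (Fin 3) (Fin 3) ℂ) * (t : Matrix (Fin 3) (Fin 3) ℂ)) a j = _
  rw [← ht'.diagonal_diag, Matrix.mul_diagonal]
  simp [col, mul_comm]

/-- The map `τ_{j+1} : SU(3)/T² → ℂP²`, `[(e₁, e₂, e₃)] ↦ span e_{j+1}`. -/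
noncomputable def tau (j : Fin 3) : Flag → CP2 :=
  Quotient.lift (fun g : SU3 => Projectivization.mk ℂ (col g j) (col_ne_zero g j)) (by
    intro g g' h
    obtain ⟨t, ht, rfl⟩ := (rel_iff g g').1 h
    refine ((Projectivization.mk_eq_mk_iff' ℂ _ _ _ _).2 ⟨_, (col_mul_torus g t ht j).symm⟩).symm)

/-- The cyclically permuted frame `(e_{i+1}, e_{i+2}, e_{i+3})`, indices modulo `3`. -/
def cycFrame (i : Fin 3) (g : SU3) : SU3 :=
  ⟨(g : Matrix (Fin 3) (Fin 3) ℂ).submatrix id (fun j => j + i), by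
    have hg := Matrix.mem_specialUnitaryGroup_iff.1 g.2
    refine Matrix.mem_specialUnitaryGroup_iff.2 ⟨?_, ?_⟩
    · rw [Matrix.mem_unitaryGroup_iff']
      have h := Matrix.mem_unitaryGroup_iff'.1 hg.1
      rw [Matrix.star_eq_conjTranspose, Matrix.conjTranspose_submatrix,
        ← Matrix.submatrix_mul _ _ _ id _ Function.bijective_id, ← Matrix.star_eq_conjTranspose, h]
      exact Matrix.submatrix_one _ (add_left_injective i)
    · have h := hg.2
      rw [Matrix.det_fin_three] at h ⊢
      fin_cases i <;> simp [Matrix.submatrix_apply] at h ⊢ <;> linear_combination h⟩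

/-- On flags: `[(e₁, e₂, e₃)] ↦ (span e_{i+1}, span (e_{i+1}, e_{i+2}))`, indices modulo `3`. -/
def cyc (i : Fin 3) : Flag → Flag :=
  Quotient.map (cycFrame i) (by
    intro g g' h
    obtain ⟨t, ht, rfl⟩ := (rel_iff g g').1 h
    change QuotientGroup.leftRel T2 _ _
    rw [QuotientGroup.leftRel_apply]
    have hg := Matrix.mem_unitaryGroup_iff'.1 (Matrix.mem_specialUnitaryGroup_iff.1 g.2).1
    have ht' : (t : Matrix (Fin 3) (Fin 3) ℂ).IsDiag := ht
    change (star ((g : Matrix (Fin 3) (Fin 3) ℂ).submatrix id (fun j => j + i)) *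
      ((g : Matrix (Fin 3) (Fin 3) ℂ) * (t : Matrix (Fin 3) (Fin 3) ℂ)).submatrix id
        (fun j => j + i)).IsDiag
    rw [Matrix.star_eq_conjTranspose, Matrix.conjTranspose_submatrix,
      ← Matrix.submatrix_mul _ _ _ id _ Function.bijective_id, ← Matrix.mul_assoc,
      ← Matrix.star_eq_conjTranspose, hg, Matrix.one_mul]
    exact ht'.submatrix (add_left_injective i))

variable {S : Type*} [TopologicalSpace S] [ChartedSpace ℂ S]

/-! Below, `S` is a Riemann surface. The tangent space of `S` at `p` is `ℂ` (read in the preferred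
holomorphic chart at `p`), so the complex structure of `S` is multiplication by `Complex.I`. -/

/-- The derivative `(d e_{j+1})(v)` at `p` of a column of a map `e` into `SU(3)`. -/
noncomputable def dcol (e : S → SU3) (p : S) (v : ℂ) (j : Fin 3) : Fin 3 → ℂ :=
  fun a => (mfderiv 𝓘(ℝ, ℂ) 𝓘(ℝ, ℂ) (fun q => col (e q) j a) p v : ℂ)

/-- The pullback `γ = e⁻¹ de` of the Maurer-Cartan form of `SU(3)` by `e`, applied to the tangent
vector `v` at `p`: its `(j, k)` entry is `⟨e_j, d e_k (v)⟩`. -/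
noncomputable def maurerCartan (e : S → SU3) (p : S) (v : ℂ) : Matrix (Fin 3) (Fin 3) ℂ :=
  star (e p : Matrix (Fin 3) (Fin 3) ℂ) * Matrix.of (fun a k => dcol e p v k a)

/-- The `ℂ`-valued `1`-forms `η₁ = γ₃₂`, `η₂ = γ₁₃`, `η₃ = γ₂₁` pulled back by `e`. -/
noncomputable def eta (e : S → SU3) (p : S) (v : ℂ) : Fin 3 → ℂ :=
  ![maurerCartan e p v 2 1, maurerCartan e p v 0 2, maurerCartan e p v 1 0]

/-- `e` is a smooth lift of `f : S → SU(3)/T²` to `SU(3)` over the open set `U`. -/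
structure IsLocalFrame (f : S → Flag) (U : Set S) (e : S → SU3) : Prop where
  isOpen : IsOpen U
  smooth : ∀ j a, ContMDiffOn 𝓘(ℝ, ℂ) 𝓘(ℝ, ℂ) ∞ (fun q => col (e q) j a) U
  lift : ∀ q ∈ U, proj (e q) = f q

/-- Smoothness of a map into `SU(3)/T²`. As `SU(3) → SU(3)/T²` is a smooth principal bundle,
this is the existence of smooth local lifts. -/
def IsSmooth (f : S → Flag) : Prop :=
  ∀ p, ∃ U e, p ∈ U ∧ IsLocalFrame f U e

/-- `f` is an immersed pseudo-holomorphic curve for the almost complex structure on `SU(3)/T²`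
whose `(1,0)`-forms are those that pull back to the span of `η₁, η₂, η₃` on `SU(3)`: it is smooth,
it pulls `(1,0)`-forms back to `(1,0)`-forms, and its differential is injective. -/
structure IsJHolomorphicCurve (f : S → Flag) : Prop where
  smooth : IsSmooth f
  holo : ∀ U e, IsLocalFrame f U e → ∀ p ∈ U, ∀ v i,
    eta e p (Complex.I * v) i = Complex.I * eta e p v i
  immersed : ∀ U e, IsLocalFrame f U e → ∀ p ∈ U, ∀ v, eta e p v = 0 → v = 0

/-- The cubic form `C = η₁ η₂ η₃` at the tangent vector `v`, in a local frame; if `σ` is a unitary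
coframe of `S` and `η_i = A_i σ`, this is `A₁ A₂ A₃ σ³`. -/
noncomputable def cubicForm (e : S → SU3) (p : S) (v : ℂ) : ℂ :=
  eta e p v 0 * eta e p v 1 * eta e p v 2

/-- A pseudo-holomorphic curve whose cubic form vanishes identically. -/
structure IsSuperholomorphic (f : S → Flag) : Prop extends IsJHolomorphicCurve f where
  cubic_eq_zero : ∀ U e, IsLocalFrame f U e → ∀ p ∈ U, ∀ v, cubicForm e p v = 0

/-- A holomorphic curve in `ℂP²`: a non-constant map from `S` that is locally given by holomorphic
homogeneous coordinates. It may have branch points. -/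
structure IsHolomorphicCurve (h : S → CP2) : Prop where
  holo : ∀ p, ∃ (U : Set S) (w : S → Fin 3 → ℂ), IsOpen U ∧ p ∈ U ∧
    MDifferentiableOn 𝓘(ℂ) 𝓘(ℂ, Fin 3 → ℂ) w U ∧
    ∀ q ∈ U, ∃ hw : w q ≠ 0, h q = Projectivization.mk ℂ (w q) hw
  nonconstant : ∃ p q, h p ≠ h q

/-- `F` is the Frenet frame of `h`: a smooth frame field, up to `T²`, with `h = span e₁` and
`d e₁` valued in `span (e₁, e₂)`. (For `h` holomorphic and non-constant on a connected `S` it is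
unique: it is determined away from the isolated branch points, hence everywhere by continuity.) -/
structure IsFrenetFrame (h : S → CP2) (F : S → Flag) : Prop where
  smooth : IsSmooth F
  line : ∀ p, tau 0 (F p) = h p
  tangent : ∀ U e, IsLocalFrame F U e → ∀ p ∈ U, ∀ v,
    dcol e p v 0 ∈ Submodule.span ℂ {col (e p) 0, col (e p) 1}

/-- The `(i+1)`-st lift of a curve with Frenet frame `F = [(e₁, e₂, e₃)]`:
`f₁ = (e₁, span (e₁, e₂))`, `f₂ = (e₂, span (e₂, e₃))`, `f₃ = (e₃, span (e₃, e₁))`. -/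
def frenetLift (i : Fin 3) (F : S → Flag) : S → Flag := fun p => cyc i (F p)

end FlagCurves

/-!
Let `e` be a local lift of `f` to `SU(3)` and write the pulled back forms as `η_i = A_i dz` in a
holomorphic chart. The proof has three ingredients.

*Each `η_i` satisfies unique continuation.* The Maurer–Cartan equation `dγ = -γ ∧ γ` gives
`dη₃ = (γ₁₁ - γ₂₂) ∧ η₃ - η̄₁ ∧ η̄₂`, and the last term vanishes on a surface because both factors
are of type `(0,1)` (`IsLocalFrame.dbar_eta`). So `A₃` solves a linear equation `2 ∂A/∂z̄ = β A`
with smooth `β`. The Cauchy transform solves `2 ∂u/∂z̄ = β` locally (`exists_dbar_eq`, from the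
Cauchy–Pompeiu formula), so that `A e^{-u}` is holomorphic, and a solution that vanishes on an open
set vanishes on every disc that meets it (`eqOn_zero_of_dbar_eq_mul`). The same holds for the other
`η_i` by the cyclic symmetry of the flag manifold. Hence the set of points near which `η_i` vanishes
(`etaZeroSet`, independent of the lift) is open and closed, so it is empty or everything.

*The position of the vanishing factor.* As `A₁ A₂ A₃ = 0`, one factor vanishes on a non-empty open
set, hence identically, and as `f` is an immersion not all three do. In the cyclic order there is
therefore a factor that vanishes identically and is followed by one that does not
(`IsSuperholomorphic.exists_etaZeroSet_eq`). After a cyclic permutation `F` of `f` these are `η₂`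
and `η₃`.

*The permuted flag is a Frenet frame.* If `η₂ = γ₁₃` vanishes, so does `γ₃₁ = -η̄₂`, and
`de₁ = γ₁₁ e₁ + η₃ e₂`. This is the Frenet condition, and since `η₃` is of type `(1,0)` the
quotients of the components of `e₁` are holomorphic functions, so `span e₁` is a holomorphic map to `ℂP²`.
If it were constant, `η₃` would vanish.
-/

namespace FlagCurves

/-! ### The inhomogeneous Cauchy–Riemann equation and unique continuation -/

section Dbar

open Complex MeasureTheory Set

theorem locallyIntegrable_inv : LocallyIntegrable (fun w : ℂ => w⁻¹) volume := by
  refine locallyIntegrable_of_norm_le_rpow (C := 1) (α := 1) (by simp) (by simp)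
    ?_ (measurable_inv.aestronglyMeasurable)
  filter_upwards with w
  simp [Real.rpow_neg_one]

/-- The **Cauchy–Pompeiu formula** at the origin, for compactly supported functions. -/
theorem integral_inv_mul_dbar {h : ℂ → ℂ} (hh : ContDiff ℝ 1 h) (hc : HasCompactSupport h) :
    ∫ w, w⁻¹ * (fderiv ℝ h w 1 + I * fderiv ℝ h w I) = -(2 * Real.pi) * h 0 := by
  set e : ℝ → ℂ := fun θ => Real.cos θ + Real.sin θ * I with he
  have hec : Continuous e := by fun_prop
  have he1 : ∀ θ, ‖e θ‖ = 1 := fun θ => by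
    have := Complex.norm_exp_ofReal_mul_I θ
    rwa [Complex.exp_mul_I, ← Complex.ofReal_cos, ← Complex.ofReal_sin] at this
  have hed : ∀ θ, HasDerivAt e (I * e θ) θ := fun θ => by
    have h1 := (Real.hasDerivAt_cos θ).ofReal_comp
    have h2 := ((Real.hasDerivAt_sin θ).ofReal_comp).mul_const I
    refine (h1.add h2).congr_deriv ?_
    simp only [he]; push_cast; linear_combination (-(Complex.sin θ)) * I_mul_I
  have hD : ∀ w, HasFDerivAt h (fderiv ℝ h w) w := fun w =>
    (hh.differentiable one_ne_zero w).hasFDerivAt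
  have hDc : Continuous (fderiv ℝ h) := hh.continuous_fderiv one_ne_zero
  -- the radial derivative, and the angular derivative divided by the radius
  set G₁ : ℝ × ℝ → ℂ := fun p => fderiv ℝ h (p.1 * e p.2) (e p.2) with hG₁
  set G₂ : ℝ × ℝ → ℂ := fun p => fderiv ℝ h (p.1 * e p.2) (I * e p.2) with hG₂
  have hG₁c : Continuous G₁ :=
    (hDc.comp (by fun_prop)).clm_apply (by fun_prop)
  have hG₂c : Continuous G₂ :=
    (hDc.comp (by fun_prop)).clm_apply (by fun_prop)
  obtain ⟨R, hR⟩ : ∃ R : ℝ, ∀ w : ℂ, R < ‖w‖ → fderiv ℝ h w = 0 ∧ h w = 0 := by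
    obtain ⟨R, hR⟩ := hc.isCompact.isBounded.subset_closedBall 0
    refine ⟨R, fun w hw => ?_⟩
    have hw' : w ∉ tsupport h := fun hmem => by
      have := hR hmem
      simp only [Metric.mem_closedBall, dist_zero_right] at this
      exact absurd hw (not_lt.2 this)
    refine ⟨?_, image_eq_zero_of_notMem_tsupport hw'⟩
    exact image_eq_zero_of_notMem_tsupport fun hmem => hw' (tsupport_fderiv_subset ℝ hmem)
  have hint : ∀ G : ℝ × ℝ → ℂ, Continuous G → (∀ r θ, R < r → G (r, θ) = 0) →
      IntegrableOn G (Ioi 0 ×ˢ Ioo (-Real.pi) Real.pi) (volume.prod volume) := by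
    intro G hG h0
    have hK : IntegrableOn G (Icc 0 R ×ˢ Icc (-Real.pi) Real.pi) (volume.prod volume) :=
      hG.continuousOn.integrableOn_compact (isCompact_Icc.prod isCompact_Icc)
    refine hK.of_forall_sdiff_eq_zero (measurableSet_Ioi.prod measurableSet_Ioo) ?_
    rintro ⟨r, θ⟩ ⟨⟨hr, hθ⟩, hn⟩
    refine h0 r θ (not_le.1 fun hle => hn ⟨⟨le_of_lt hr, hle⟩, Ioo_subset_Icc_self hθ⟩)
  have hnorm : ∀ r θ, R < r → R < ‖(r : ℂ) * e θ‖ := fun r θ hr => by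
    rw [norm_mul, he1, mul_one, Complex.norm_real]
    exact hr.trans_le (le_abs_self r)
  have hi₁ := hint G₁ hG₁c fun r θ hr => by simp [hG₁, (hR _ (hnorm r θ hr)).1]
  have hi₂ := hint G₂ hG₂c fun r θ hr => by simp [hG₂, (hR _ (hnorm r θ hr)).1]
  -- in polar coordinates the Jacobian `r` cancels the kernel, and
  -- `e^{-iθ} (h_x + i h_y) = G₁ + i G₂`
  have hpolar : ∫ w, w⁻¹ * (fderiv ℝ h w 1 + I * fderiv ℝ h w I) =
      ∫ p in Ioi 0 ×ˢ Ioo (-Real.pi) Real.pi, (G₁ p + I * G₂ p) := by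
    rw [← Complex.integral_comp_polarCoord_symm]
    refine setIntegral_congr_fun (measurableSet_Ioi.prod measurableSet_Ioo) ?_
    rintro ⟨r, θ⟩ ⟨hr, -⟩
    have hr' : (r : ℂ) ≠ 0 := by exact_mod_cast (ne_of_gt hr : r ≠ 0)
    have hen : e θ ≠ 0 := norm_ne_zero_iff.1 (by rw [he1]; exact one_ne_zero)
    have hlin : ∀ (L : ℂ →L[ℝ] ℂ) (x y : ℝ), L (x + y * I) = x * L 1 + y * L I := by
      intro L x y
      have : (x + y * I : ℂ) = x • (1 : ℂ) + y • I := by simp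
      rw [this, map_add, map_smul, map_smul]; simp
    have hIe : I * e θ = ((-Real.sin θ : ℝ) : ℂ) + (Real.cos θ : ℝ) * I := by
      simp only [he]; push_cast; linear_combination (Complex.sin θ) * I_mul_I
    have hinv : (e θ)⁻¹ = Real.cos θ - Real.sin θ * I := by
      refine inv_eq_of_mul_eq_one_right ?_
      simp only [he]
      have := Complex.sin_sq_add_cos_sq (θ : ℂ)
      push_cast
      linear_combination this - (Complex.sin θ) ^ 2 * I_mul_I
    simp only [Complex.polarCoord_symm_apply, hG₁, hG₂]
    change r • (((r : ℂ) * e θ)⁻¹ * (fderiv ℝ h (r * e θ) 1 + I * fderiv ℝ h (r * e θ) I)) = _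
    rw [hIe, hlin, mul_inv, hinv, real_smul, ← mul_assoc, ← mul_assoc, mul_inv_cancel₀ hr',
      one_mul]
    rw [show e θ = (Real.cos θ : ℂ) + (Real.sin θ : ℝ) * I from rfl, hlin]
    push_cast
    linear_combination (-(Complex.sin θ) *
      fderiv ℝ h (r * (Complex.cos θ + Complex.sin θ * I)) I) * I_mul_I
  -- integrating radially first leaves the boundary term at the origin
  have h₁ : ∫ p in Ioi 0 ×ˢ Ioo (-Real.pi) Real.pi, G₁ p = -(2 * Real.pi) * h 0 := by
    rw [Measure.volume_eq_prod, ← setIntegral_prod_swap,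
      setIntegral_prod (fun z => G₁ z.swap) hi₁.swap]
    have : ∀ θ, ∫ r in Ioi (0 : ℝ), G₁ (r, θ) = -h 0 := by
      intro θ
      have hd : ∀ r : ℝ, HasDerivAt (fun r : ℝ => h (r * e θ)) (G₁ (r, θ)) r := fun r => by
        have h2 := ((hasDerivAt_id r).ofReal_comp).mul_const (e θ)
        refine HasDerivAt.congr_deriv (HasFDerivAt.comp_hasDerivAt r (hD (r * e θ)) h2) ?_
        simp [hG₁]
      have hcd : ContDiff ℝ 1 (fun r : ℝ => h (r * e θ)) :=
        hh.comp ((ofRealCLM.contDiff).mul contDiff_const)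
      have hcs : HasCompactSupport (fun r : ℝ => h (r * e θ)) := by
        refine HasCompactSupport.intro (isCompact_Icc (a := -R) (b := R)) fun r hr => ?_
        refine (hR _ ?_).2
        rw [norm_mul, he1, mul_one, Complex.norm_real]
        by_contra hle
        exact hr (abs_le.1 (not_lt.1 hle))
      have := hcs.integral_Ioi_deriv_eq hcd 0
      simpa [(hd _).deriv] using this
    simp only [Prod.swap_prod_mk, this]
    simp [two_mul, Real.pi_pos.le]
    ring
  -- integrating over the angle first gives zero by periodicity
  have h₂ : ∫ p in Ioi 0 ×ˢ Ioo (-Real.pi) Real.pi, G₂ p = 0 := by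
    rw [Measure.volume_eq_prod, setIntegral_prod _ hi₂]
    refine setIntegral_eq_zero_of_forall_eq_zero fun r hr => ?_
    have hr' : (r : ℂ) ≠ 0 := by exact_mod_cast (ne_of_gt hr : r ≠ 0)
    have hd : ∀ θ : ℝ, HasDerivAt (fun θ : ℝ => h (r * e θ)) (r * G₂ (r, θ)) θ := fun θ => by
      have h2 := (hed θ).const_mul (r : ℂ)
      refine ((hD (r * e θ)).comp_hasDerivAt θ h2).congr_deriv ?_
      rw [← real_smul (x := r) (z := I * e θ), map_smul, real_smul]
    have hcont : Continuous fun θ => (r : ℂ) * G₂ (r, θ) := by fun_prop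
    have hFTC := intervalIntegral.integral_eq_sub_of_hasDerivAt
      (fun θ (_ : θ ∈ uIcc (-Real.pi) Real.pi) => hd θ) (hcont.intervalIntegrable _ _)
    have hper : e Real.pi = e (-Real.pi) := by simp [he]
    rw [hper, sub_self, intervalIntegral.integral_const_mul] at hFTC
    rw [← integral_Ioc_eq_integral_Ioo, ← intervalIntegral.integral_of_le
      (by linarith [Real.pi_pos])]
    exact (mul_eq_zero.1 hFTC).resolve_left hr'
  rw [hpolar, integral_add (Measure.volume_eq_prod ℝ ℝ ▸ hi₁)
    ((Measure.volume_eq_prod ℝ ℝ ▸ hi₂).const_mul I), integral_const_mul, h₁, h₂]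
  simp

/-- The inhomogeneous Cauchy–Riemann equation `2 ∂u/∂z̄ = g` has a solution on `ℂ` for `g` of
class `C¹` with compact support, namely the Cauchy transform of `g`. -/
theorem exists_dbar_eq {g : ℂ → ℂ} (hg : ContDiff ℝ 1 g) (hc : HasCompactSupport g) :
    ∃ u : ℂ → ℂ, Differentiable ℝ u ∧ ∀ z, fderiv ℝ u z 1 + I * fderiv ℝ u z I = g z := by
  set k : ℂ → ℂ := fun w => w⁻¹
  set L := ContinuousLinearMap.mul ℝ ℂ
  have hd := fun z => hc.hasFDerivAt_convolution_right L locallyIntegrable_inv hg z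
  set v : ℂ → ℂ := MeasureTheory.convolution k g L volume
  have hv : ∀ z x, fderiv ℝ v z x = ∫ t, t⁻¹ * fderiv ℝ g (z - t) x := by
    intro z x
    have hex := (hc.fderiv ℝ).convolutionExists_right (L.precompR ℂ) locallyIntegrable_inv
      (hg.continuous_fderiv one_ne_zero) z
    rw [(hd z).fderiv, MeasureTheory.convolution, ContinuousLinearMap.integral_apply hex]
    rfl
  have hint : ∀ z x, Integrable fun t : ℂ => t⁻¹ * fderiv ℝ g (z - t) x := by
    intro z x
    have hex := (hc.fderiv_apply ℝ x).convolutionExists_right L locallyIntegrable_inv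
      ((hg.continuous_fderiv one_ne_zero).clm_apply continuous_const) z
    exact hex
  refine ⟨fun z => (2 * Real.pi : ℂ)⁻¹ * v z,
    fun z => ((hd z).differentiableAt).const_mul _, fun z => ?_⟩
  have hπ : (2 * Real.pi : ℂ) ≠ 0 := by simp [Real.pi_ne_zero]
  rw [fderiv_const_mul (hd z).differentiableAt]
  simp only [_root_.smul_apply, smul_eq_mul, hv]
  have hh : ContDiff ℝ 1 fun t => g (z - t) := hg.comp (contDiff_const.sub contDiff_id)
  have hhc : HasCompactSupport fun t => g (z - t) :=
    hc.comp_homeomorph (Homeomorph.subLeft z)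
  have hP := integral_inv_mul_dbar hh hhc
  have hder : ∀ t x, fderiv ℝ (fun t => g (z - t)) t x = -fderiv ℝ g (z - t) x := by
    intro t x
    have h1 : HasFDerivAt (fun t : ℂ => z - t) (-ContinuousLinearMap.id ℝ ℂ) t :=
      (hasFDerivAt_id t).const_sub z
    have h2 := (hg.differentiable one_ne_zero (z - t)).hasFDerivAt.comp t h1
    rw [show (fun t => g (z - t)) = g ∘ fun t => z - t from rfl, h2.fderiv]
    simp
  have : ∫ t, t⁻¹ * (fderiv ℝ (fun t => g (z - t)) t 1 + I * fderiv ℝ (fun t => g (z - t)) t I)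
      = -((∫ t, t⁻¹ * fderiv ℝ g (z - t) 1) + I * ∫ t, t⁻¹ * fderiv ℝ g (z - t) I) := by
    rw [← integral_const_mul, ← integral_add (hint z 1) ((hint z I).const_mul I), ← integral_neg]
    congr 1; ext t
    rw [hder, hder]; ring
  rw [this, sub_zero] at hP
  rw [mul_left_comm, ← mul_add, inv_mul_eq_iff_eq_mul₀ hπ]
  linear_combination -hP

/-- **Unique continuation** for solutions of `2 ∂A/∂z̄ = β A`: a solution on a neighbourhood of a
closed disc that vanishes near one point of the open disc vanishes on the whole open disc. -/
theorem eqOn_zero_of_dbar_eq_mul {V : Set ℂ} (hV : IsOpen V) {A β : ℂ → ℂ}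
    (hA : DifferentiableOn ℝ A V) (hβ : ContDiffOn ℝ ∞ β V)
    (hAβ : ∀ z ∈ V, fderiv ℝ A z 1 + I * fderiv ℝ A z I = β z * A z)
    {z₀ : ℂ} {r : ℝ} (hr : 0 < r) (hrV : Metric.closedBall z₀ r ⊆ V)
    {z₁ : ℂ} (hz₁ : z₁ ∈ Metric.ball z₀ r) (h0 : A =ᶠ[nhds z₁] 0) :
    EqOn A 0 (Metric.ball z₀ r) := by
  -- a smooth cutoff makes `β` compactly supported without changing it on the disc
  obtain ⟨χ, hχs, hχK, hχ1⟩ : ∃ χ : ℂ → ℝ, ContDiff ℝ ∞ χ ∧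
      (HasCompactSupport χ ∧ tsupport χ ⊆ V) ∧ ∀ z ∈ Metric.closedBall z₀ r, χ z = 1 := by
    obtain ⟨R, hrR, hRV⟩ : ∃ R, r < R ∧ Metric.closedBall z₀ R ⊆ V := by
      obtain ⟨δ, hδ, hδV⟩ := (isCompact_closedBall z₀ r).exists_cthickening_subset_open hV hrV
      refine ⟨r + δ, by linarith, ?_⟩
      rw [cthickening_closedBall hδ.le hr.le] at hδV
      rwa [add_comm]
    let b : ContDiffBump z₀ := ⟨r, R, hr, hrR⟩
    refine ⟨b, b.contDiff, ⟨b.hasCompactSupport, ?_⟩, fun z hz => b.one_of_mem_closedBall hz⟩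
    rw [b.tsupport_eq]; exact hRV
  set g : ℂ → ℂ := fun z => χ z * β z
  have hg : ContDiff ℝ ∞ g := by
    refine contDiff_iff_contDiffAt.2 fun z => ?_
    by_cases hz : z ∈ V
    · exact (ofRealCLM.contDiff.contDiffAt.comp z hχs.contDiffAt).mul
        (hβ.contDiffAt (hV.mem_nhds hz))
    · have : g =ᶠ[nhds z] 0 := by
        have hz' : z ∉ tsupport χ := fun h => hz (hχK.2 h)
        filter_upwards [(isClosed_tsupport χ).isOpen_compl.mem_nhds hz'] with y hy
        simp [g, image_eq_zero_of_notMem_tsupport hy]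
      exact (contDiffAt_const (c := (0 : ℂ))).congr_of_eventuallyEq this
  have hgc : HasCompactSupport g := by
    refine HasCompactSupport.intro hχK.1.isCompact fun z hz => ?_
    simp [g, image_eq_zero_of_notMem_tsupport hz]
  obtain ⟨u, hu, hug⟩ := exists_dbar_eq (hg.of_le (by simp)) hgc
  -- dividing `A` by the exponential of a solution of `2 ∂u/∂z̄ = β` makes it holomorphic
  set B : ℂ → ℂ := fun z => A z * cexp (-u z)
  have hB : DifferentiableOn ℂ B (Metric.ball z₀ r) := by
    intro z hz
    have hzc := Metric.ball_subset_closedBall hz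
    have hzV := hrV hzc
    have hAz := (hA.differentiableAt (hV.mem_nhds hzV)).hasFDerivAt
    have hE : HasFDerivAt (fun z => cexp (-u z)) (cexp (-u z) • -fderiv ℝ u z) z :=
      (hu z).hasFDerivAt.neg.cexp
    have hBz := hAz.mul hE
    refine (differentiableAt_complex_iff_differentiableAt_real.2
      ⟨hBz.differentiableAt, ?_⟩).differentiableWithinAt
    have hBf : fderiv ℝ B z = _ := hBz.fderiv
    have e1 := hAβ z hzV
    have e2 := hug z
    simp only [g, hχ1 z hzc, ofReal_one, one_mul] at e2
    change fderiv ℝ B z I = I • fderiv ℝ B z 1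
    rw [hBf]
    simp only [_root_.add_apply, _root_.smul_apply, smul_eq_mul,
      _root_.neg_apply]
    linear_combination (-I * cexp (-u z)) * e1 + (I * A z * cexp (-u z)) * e2
      + (cexp (-u z) * (fderiv ℝ A z I - A z * fderiv ℝ u z I)) * I_mul_I
  have hBan : AnalyticOnNhd ℂ B (Metric.ball z₀ r) := hB.analyticOnNhd Metric.isOpen_ball
  have hB0 : B =ᶠ[nhds z₁] 0 := by
    filter_upwards [h0] with z hz
    simp [B, hz]
  have := hBan.eqOn_zero_of_preconnected_of_eventuallyEq_zero
    (convex_ball z₀ r).isPreconnected hz₁ hB0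
  intro z hz
  have hz0 : A z * cexp (-u z) = 0 := this hz
  exact (mul_eq_zero.1 hz0).resolve_right (Complex.exp_ne_zero _)

end Dbar

/-! ### Frames in holomorphic charts, and the cyclic symmetry -/

section Charts

variable {S : Type*} [TopologicalSpace S] [ChartedSpace ℂ S]

/-- A Riemann surface is a smooth real manifold. -/
theorem isManifold_real (S : Type*) [TopologicalSpace S] [ChartedSpace ℂ S]
    [IsManifold 𝓘(ℂ) ω S] : IsManifold 𝓘(ℝ, ℂ) ∞ S := by
  refine isManifold_of_contDiffOn _ _ _ fun e e' he he' => ?_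
  have h := StructureGroupoid.compatible (contDiffGroupoid ω 𝓘(ℂ)) he he'
  rw [contDiffGroupoid, mem_groupoid_of_pregroupoid, contDiffPregroupoid] at h
  exact (h.1.restrict_scalars ℝ).of_le (by simp)

/-- In a holomorphic chart, the derivative at `p` of functions on a Riemann surface becomes that of
their coordinate expressions, up to a non-zero complex factor that depends on `p` only: the
derivative at `p` of the transition to the preferred chart at `p`. -/
theorem exists_mfderiv_eq_fderiv_chart [IsManifold 𝓘(ℂ) ω S] (p₀ : S) {p : S}
    (hp : p ∈ (chartAt ℂ p₀).source) :
    ∃ c : ℂ, c ≠ 0 ∧ ∀ G : S → ℂ, MDifferentiableAt 𝓘(ℝ, ℂ) 𝓘(ℝ, ℂ) G p → ∀ v : ℂ,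
      (mfderiv 𝓘(ℝ, ℂ) 𝓘(ℝ, ℂ) G p v : ℂ) =
        fderiv ℝ (fun z => G ((chartAt ℂ p₀).symm z)) (chartAt ℂ p₀ p) (c * v) := by
  have := isManifold_real S
  have : IsManifold 𝓘(ℂ) 1 S := IsManifold.of_le (n := ω) (by simp)
  have : IsManifold 𝓘(ℝ, ℂ) 1 S := IsManifold.of_le (n := ∞) (by simp)
  set φ := chartAt ℂ p₀
  have hφ := (mdifferentiable_chart (I := 𝓘(ℂ)) p₀).mdifferentiableAt hp
  set T : ℂ →L[ℂ] ℂ := mfderiv 𝓘(ℂ) 𝓘(ℂ) φ p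
  have hTd : HasMFDerivAt 𝓘(ℂ) 𝓘(ℂ) φ p T := hφ.hasMFDerivAt
  have hTR : HasMFDerivAt 𝓘(ℝ, ℂ) 𝓘(ℝ, ℂ) φ p (T.restrictScalars ℝ) :=
    ⟨hTd.1, hTd.2.restrictScalars ℝ⟩
  have hlin : ∀ v, T v = T 1 * v := fun v => by
    have := T.map_smul v 1
    simpa [mul_comm] using this
  refine ⟨T 1, fun h0 => ?_, fun G hG v => ?_⟩
  · have hinj := (mdifferentiable_chart (I := 𝓘(ℂ)) p₀).mfderiv_injective hp
    have h1 : T 1 = T 0 := by rw [h0, map_zero]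
    exact one_ne_zero (α := ℂ) (hinj h1)
  · have hsymm := (mdifferentiable_chart (I := 𝓘(ℝ, ℂ)) p₀).mdifferentiableAt_symm
      (φ.map_source hp)
    have hG' : MDifferentiableAt 𝓘(ℝ, ℂ) 𝓘(ℝ, ℂ) (fun z => G (φ.symm z)) (φ p) := by
      refine MDifferentiableAt.comp (I' := 𝓘(ℝ, ℂ)) (φ p) ?_ hsymm
      rwa [φ.left_inv hp]
    have hcomp := hG'.hasMFDerivAt.comp p hTR
    have heq : G =ᶠ[nhds p] (fun z => G (φ.symm z)) ∘ φ := by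
      filter_upwards [φ.open_source.mem_nhds hp] with q hq
      simp [φ.left_inv hq]
    rw [(hcomp.congr_of_eventuallyEq heq).mfderiv, mfderiv_eq_fderiv]
    change fderiv ℝ _ _ (T v) = _
    rw [hlin]
    rfl

/-- A frame read in a holomorphic chart is a frame on an open subset of `ℂ`. -/
theorem IsLocalFrame.comp_chart_symm [IsManifold 𝓘(ℂ) ω S] {f : S → Flag} {U : Set S}
    {e : S → SU3} (he : IsLocalFrame f U e) (p₀ : S) :
    IsLocalFrame (f ∘ (chartAt ℂ p₀).symm) ((chartAt ℂ p₀).target ∩ (chartAt ℂ p₀).symm ⁻¹' U)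
      (e ∘ (chartAt ℂ p₀).symm) where
  isOpen := (chartAt ℂ p₀).isOpen_inter_preimage_symm he.isOpen
  smooth j a := by
    have := isManifold_real S
    exact (he.smooth j a).comp ((contMDiffOn_chart_symm (I := 𝓘(ℝ, ℂ)) (n := ∞) (x := p₀)).mono
      Set.inter_subset_left) fun z hz => hz.2
  lift q hq := he.lift _ hq.2

theorem IsLocalFrame.mdifferentiableAt {f : S → Flag} {U : Set S} {e : S → SU3}
    (he : IsLocalFrame f U e) {p : S} (hp : p ∈ U) (j a : Fin 3) :
    MDifferentiableAt 𝓘(ℝ, ℂ) 𝓘(ℝ, ℂ) (fun q => col (e q) j a) p :=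
  ((he.smooth j a).contMDiffAt (he.isOpen.mem_nhds hp)).mdifferentiableAt (by simp)

theorem exists_dcol_chart [IsManifold 𝓘(ℂ) ω S] (p₀ : S) {p : S}
    (hp : p ∈ (chartAt ℂ p₀).source) :
    ∃ c : ℂ, c ≠ 0 ∧ ∀ (f : S → Flag) (U : Set S) (e : S → SU3), IsLocalFrame f U e → p ∈ U →
      ∀ v, dcol e p v = dcol (e ∘ (chartAt ℂ p₀).symm) (chartAt ℂ p₀ p) (c * v) := by
  obtain ⟨c, hc, h⟩ := exists_mfderiv_eq_fderiv_chart p₀ hp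
  refine ⟨c, hc, fun f U e he hpU v => ?_⟩
  funext j a
  rw [dcol, h _ (he.mdifferentiableAt hpU j a), dcol, mfderiv_eq_fderiv]
  rfl

/-- The Maurer–Cartan form in a holomorphic chart. -/
theorem exists_maurerCartan_chart [IsManifold 𝓘(ℂ) ω S] (p₀ : S) {p : S}
    (hp : p ∈ (chartAt ℂ p₀).source) :
    ∃ c : ℂ, c ≠ 0 ∧ ∀ (f : S → Flag) (U : Set S) (e : S → SU3), IsLocalFrame f U e → p ∈ U →
      ∀ v, maurerCartan e p v =
        maurerCartan (e ∘ (chartAt ℂ p₀).symm) (chartAt ℂ p₀ p) (c * v) := by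
  obtain ⟨c, hc, h⟩ := exists_dcol_chart p₀ hp
  refine ⟨c, hc, fun f U e he hpU v => ?_⟩
  simp only [maurerCartan, h f U e he hpU v, Function.comp_apply, (chartAt ℂ p₀).left_inv hp]

theorem maurerCartan_apply (e : S → SU3) (p : S) (v : ℂ) (j k : Fin 3) :
    maurerCartan e p v j k = ∑ a, star (col (e p) j a) * dcol e p v k a := rfl

theorem sum_star_col_mul_col (g : SU3) (j k : Fin 3) :
    ∑ a, star (col g j a) * col g k a = if j = k then 1 else 0 := by
  have h := Matrix.mem_unitaryGroup_iff'.1 (Matrix.mem_specialUnitaryGroup_iff.1 g.2).1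
  have := congrFun (congrFun h j) k
  rwa [Matrix.one_apply] at this

theorem sum_col_mul_star_col (g : SU3) (a b : Fin 3) :
    ∑ j, col g j a * star (col g j b) = if a = b then 1 else 0 := by
  have h := Matrix.mem_unitaryGroup_iff.1 (Matrix.mem_specialUnitaryGroup_iff.1 g.2).1
  have := congrFun (congrFun h a) b
  rwa [Matrix.one_apply] at this

/-- The Maurer–Cartan form expresses the derivative of a frame in the frame. -/
theorem dcol_eq_sum (e : S → SU3) (p : S) (v : ℂ) (k a : Fin 3) :
    dcol e p v k a = ∑ j, maurerCartan e p v j k * col (e p) j a := by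
  simp only [maurerCartan_apply, Finset.sum_mul]
  rw [Finset.sum_comm]
  have : ∀ b, ∑ j, star (col (e p) j b) * dcol e p v k b * col (e p) j a
      = dcol e p v k b * if a = b then 1 else 0 := fun b => by
    rw [← sum_col_mul_star_col (e p), Finset.mul_sum]
    exact Finset.sum_congr rfl fun j _ => by ring
  rw [Finset.sum_congr rfl fun b _ => this b]
  simp

theorem maurerCartan_cycFrame (i : Fin 3) (e : S → SU3) (p : S) (v : ℂ) (j k : Fin 3) :
    maurerCartan (fun q => cycFrame i (e q)) p v j k = maurerCartan e p v (j + i) (k + i) := rfl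

theorem eta_apply (e : S → SU3) (p : S) (v : ℂ) (i : Fin 3) :
    eta e p v i = maurerCartan e p v (i + 2) (i + 1) := by
  fin_cases i <;> rfl

theorem eta_cycFrame (i : Fin 3) (e : S → SU3) (p : S) (v : ℂ) (j : Fin 3) :
    eta (fun q => cycFrame i (e q)) p v j = eta e p v (j + i) := by
  rw [eta_apply, eta_apply, maurerCartan_cycFrame]
  rw [add_right_comm j 2 i, add_right_comm j 1 i]

theorem cycFrame_cycFrame (i j : Fin 3) (g : SU3) :
    cycFrame i (cycFrame j g) = cycFrame (i + j) g := by
  refine Subtype.ext (Matrix.ext fun a b => ?_)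
  change (g : Matrix (Fin 3) (Fin 3) ℂ) a (b + i + j) =
    (g : Matrix (Fin 3) (Fin 3) ℂ) a (b + (i + j))
  rw [add_assoc]

theorem cycFrame_zero (g : SU3) : cycFrame 0 g = g := by
  refine Subtype.ext (Matrix.ext fun a b => ?_)
  change (g : Matrix (Fin 3) (Fin 3) ℂ) a (b + 0) = (g : Matrix (Fin 3) (Fin 3) ℂ) a b
  rw [add_zero]

theorem cyc_proj (i : Fin 3) (g : SU3) : cyc i (proj g) = proj (cycFrame i g) := rfl

theorem cyc_cyc (i j : Fin 3) (x : Flag) : cyc i (cyc j x) = cyc (i + j) x := by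
  induction x using Quotient.inductionOn with
  | h g => exact congrArg proj (cycFrame_cycFrame i j g)

theorem cyc_zero (x : Flag) : cyc 0 x = x := by
  induction x using Quotient.inductionOn with
  | h g => exact congrArg proj (cycFrame_zero g)

theorem IsLocalFrame.comp_cyc {f : S → Flag} {U : Set S} {e : S → SU3} (he : IsLocalFrame f U e)
    (i : Fin 3) : IsLocalFrame (fun q => cyc i (f q)) U (fun q => cycFrame i (e q)) where
  isOpen := he.isOpen
  smooth j a := he.smooth (j + i) a
  lift q hq := by rw [← he.lift q hq, cyc_proj]

end Charts

/-! ### The structure equation and gauge transformations -/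

section PlaneDomain

open Complex

variable {f : ℂ → Flag} {V : Set ℂ} {e e' : ℂ → SU3}

theorem dcol_eq_fderiv (e : ℂ → SU3) (z v : ℂ) (j a : Fin 3) :
    dcol e z v j a = fderiv ℝ (fun y => col (e y) j a) z v := by
  rw [dcol, mfderiv_eq_fderiv]
  rfl

theorem IsLocalFrame.contDiffOn (he : IsLocalFrame f V e) (j a : Fin 3) :
    ContDiffOn ℝ ∞ (fun y => col (e y) j a) V :=
  contMDiffOn_iff_contDiffOn.1 (he.smooth j a)

theorem IsLocalFrame.hasFDerivAt (he : IsLocalFrame f V e) {z : ℂ} (hz : z ∈ V) (j a : Fin 3) :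
    HasFDerivAt (fun y => col (e y) j a) (fderiv ℝ (fun y => col (e y) j a) z) z :=
  (((he.contDiffOn j a).contDiffAt (he.isOpen.mem_nhds hz)).differentiableAt
    (by simp)).hasFDerivAt

theorem IsLocalFrame.hasFDerivAt_star (he : IsLocalFrame f V e) {z : ℂ} (hz : z ∈ V)
    (j a : Fin 3) :
    HasFDerivAt (fun y => star (col (e y) j a))
      (((starL' ℝ : ℂ ≃L[ℝ] ℂ) : ℂ →L[ℝ] ℂ) ∘L fderiv ℝ (fun y => col (e y) j a) z) z :=
  (he.hasFDerivAt hz j a).star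

theorem IsLocalFrame.contDiffOn_fderiv (he : IsLocalFrame f V e) (j a : Fin 3) :
    ContDiffOn ℝ ∞ (fderiv ℝ fun y => col (e y) j a) V :=
  (he.contDiffOn j a).fderiv_of_isOpen he.isOpen (by simp)

theorem IsLocalFrame.contDiffOn_maurerCartan (he : IsLocalFrame f V e) (v : ℂ) (j k : Fin 3) :
    ContDiffOn ℝ ∞ (fun z => maurerCartan e z v j k) V := by
  simp only [maurerCartan_apply, dcol_eq_fderiv]
  refine ContDiffOn.sum fun a _ => ContDiffOn.mul ?_ ?_
  · exact conjCLE.contDiff.comp_contDiffOn (he.contDiffOn j a)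
  · exact (he.contDiffOn_fderiv k a).clm_apply contDiffOn_const

/-- The derivative of the coefficients of the Maurer–Cartan form; the last term is symmetric in
`v` and `w`. -/
theorem IsLocalFrame.fderiv_maurerCartan (he : IsLocalFrame f V e) {z : ℂ} (hz : z ∈ V) (v w : ℂ)
    (j k : Fin 3) :
    fderiv ℝ (fun y => maurerCartan e y w j k) z v =
      ∑ l, star (maurerCartan e z v l j) * maurerCartan e z w l k +
        ∑ a, star (col (e z) j a) * fderiv ℝ (fderiv ℝ fun y => col (e y) k a) z v w := by
  have h : ∀ a, HasFDerivAt (fun y => star (col (e y) j a) * fderiv ℝ (fun y => col (e y) k a) y w)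
      _ z := fun a =>
    (he.hasFDerivAt_star hz j a).mul (((((he.contDiffOn_fderiv k a).contDiffAt
      (he.isOpen.mem_nhds hz)).differentiableAt (by simp)).hasFDerivAt).clm_apply
        (hasFDerivAt_const w z))
  have hs := HasFDerivAt.fun_sum (u := Finset.univ) fun a _ => h a
  have hdd : ∑ l, star (maurerCartan e z v l j) * maurerCartan e z w l k
      = ∑ a, star (dcol e z v j a) * dcol e z w k a := by
    have : ∀ l, star (maurerCartan e z v l j) * maurerCartan e z w l k
        = ∑ a, star (dcol e z v j a) * (maurerCartan e z w l k * col (e z) l a) := fun l => by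
      rw [maurerCartan_apply e z v, star_sum, Finset.sum_mul]
      refine Finset.sum_congr rfl fun a _ => ?_
      rw [star_mul', star_star]; ring
    rw [Finset.sum_congr rfl fun l _ => this l, Finset.sum_comm]
    refine Finset.sum_congr rfl fun a _ => ?_
    rw [← Finset.mul_sum, ← dcol_eq_sum]
  rw [hdd, ← Finset.sum_add_distrib]
  simp only [maurerCartan_apply, dcol_eq_fderiv]
  rw [hs.fderiv]
  simp only [_root_.sum_apply]
  refine Finset.sum_congr rfl fun a _ => ?_
  simp
  ring

/-- The Maurer–Cartan form takes values in skew-Hermitian matrices. -/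
theorem IsLocalFrame.star_maurerCartan_plane (he : IsLocalFrame f V e) {z : ℂ} (hz : z ∈ V)
    (v : ℂ) (j k : Fin 3) : star (maurerCartan e z v j k) = -maurerCartan e z v k j := by
  have h : ∀ a, HasFDerivAt (fun y => star (col (e y) k a) * col (e y) j a) _ z := fun a =>
    (he.hasFDerivAt_star hz k a).mul (he.hasFDerivAt hz j a)
  have hs := HasFDerivAt.fun_sum (u := Finset.univ) fun a _ => h a
  simp only [sum_star_col_mul_col] at hs
  have h0 := congrArg (fun L : ℂ →L[ℝ] ℂ => L v) (hs.unique (hasFDerivAt_const _ z))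
  simp only [_root_.sum_apply] at h0
  rw [eq_neg_iff_add_eq_zero, maurerCartan_apply, maurerCartan_apply, star_sum,
    ← Finset.sum_add_distrib]
  simp only [dcol_eq_fderiv]
  refine Eq.trans (Finset.sum_congr rfl fun a _ => ?_) h0
  simp
  ring

/-- The structure equation `dγ = -γ ∧ γ`. -/
theorem IsLocalFrame.structure_equation (he : IsLocalFrame f V e) {z : ℂ} (hz : z ∈ V) (v w : ℂ)
    (j k : Fin 3) :
    fderiv ℝ (fun y => maurerCartan e y w j k) z v - fderiv ℝ (fun y => maurerCartan e y v j k) z w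
      = ∑ l, (maurerCartan e z w j l * maurerCartan e z v l k
        - maurerCartan e z v j l * maurerCartan e z w l k) := by
  have hsymm : ∀ a, fderiv ℝ (fderiv ℝ fun y => col (e y) k a) z v w
      = fderiv ℝ (fderiv ℝ fun y => col (e y) k a) z w v := fun a =>
    ((he.contDiffOn k a).contDiffAt (he.isOpen.mem_nhds hz)).isSymmSndFDerivAt
      (by simpa using WithTop.coe_le_coe.2 (le_top : (2 : ℕ∞) ≤ ⊤)) v w
  rw [he.fderiv_maurerCartan hz, he.fderiv_maurerCartan hz]
  simp only [hsymm, he.star_maurerCartan_plane hz, Finset.sum_sub_distrib, neg_mul,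
    Finset.sum_neg_distrib]
  ring

/-- If the forms `η_i` are of type `(1,0)`, then the coefficient `A` of `η₃` satisfies a linear
equation `2 ∂A/∂z̄ = β A`, since `η̄₁ ∧ η̄₂` vanishes on a surface. -/
theorem IsLocalFrame.dbar_eta (he : IsLocalFrame f V e)
    (hJ : ∀ z ∈ V, ∀ v i, eta e z (I * v) i = I * eta e z v i) :
    ∃ β : ℂ → ℂ, ContDiffOn ℝ ∞ β V ∧ ∀ z ∈ V,
      fderiv ℝ (fun y => eta e y 1 2) z 1 + I * fderiv ℝ (fun y => eta e y 1 2) z I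
        = β z * eta e z 1 2 := by
  refine ⟨fun z => -I * (I * maurerCartan e z 1 0 0 - maurerCartan e z I 0 0
    + maurerCartan e z I 1 1 - I * maurerCartan e z 1 1 1), ?_, fun z hz => ?_⟩
  · have := he.contDiffOn_maurerCartan
    exact contDiffOn_const.mul ((((contDiffOn_const.mul (this 1 0 0)).sub (this I 0 0)).add
      (this I 1 1)).sub (contDiffOn_const.mul (this 1 1 1)))
  have hS := he.structure_equation hz 1 I 1 0
  have h0 := hJ z hz 1 0
  have h1 := hJ z hz 1 1
  have h2 := hJ z hz 1 2
  have hev : (fun y => maurerCartan e y I 1 0) =ᶠ[nhds z] fun y => I * maurerCartan e y 1 1 0 := by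
    filter_upwards [he.isOpen.mem_nhds hz] with y hy
    simpa [eta] using hJ y hy 1 2
  have hd : DifferentiableAt ℝ (fun y => maurerCartan e y 1 1 0) z :=
    ((he.contDiffOn_maurerCartan 1 1 0).contDiffAt (he.isOpen.mem_nhds hz)).differentiableAt
      (by simp)
  rw [hev.fderiv_eq, fderiv_const_mul hd] at hS
  simp only [eta, mul_one, Matrix.cons_val] at h0 h1 h2 ⊢
  have k1 := he.star_maurerCartan_plane hz I 2 1
  have k2 := he.star_maurerCartan_plane hz 1 2 1
  have k3 := he.star_maurerCartan_plane hz I 0 2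
  have k4 := he.star_maurerCartan_plane hz 1 0 2
  rw [h0, star_mul', k2] at k1
  rw [h1, star_mul', k4] at k3
  simp only [Fin.sum_univ_three, h2, _root_.smul_apply, smul_eq_mul] at hS
  simp only [RCLike.star_def, conj_I] at k1 k3
  -- `k1` and `k3` express `γ₂₃` and `γ₃₁` at `I` as `-I` times their values at `1`, so that the
  -- term with index `l = 2` in the structure equation cancels
  linear_combination (-I) * hS - (I * maurerCartan e z 1 2 0) * k1
    + I * maurerCartan e z 1 1 2 * k3 +
    (fderiv ℝ (fun y => maurerCartan e y 1 1 0) z 1) * I_mul_I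

/-- Two lifts of the same map differ by a diagonal gauge transformation, which multiplies each
`η_i` by a function. -/
theorem IsLocalFrame.eta_eq_zero_plane (he : IsLocalFrame f V e) (he' : IsLocalFrame f V e')
    {z : ℂ} (hz : z ∈ V) {v : ℂ} {i : Fin 3} (h : eta e z v i = 0) : eta e' z v i = 0 := by
  have hcol : ∀ y ∈ V, ∀ k, ∃ c : ℂ, col (e' y) k = c • col (e y) k := fun y hy k => by
    have hp : proj (e y) = proj (e' y) := (he.lift y hy).trans (he'.lift y hy).symm
    obtain ⟨t, ht, h'⟩ := (rel_iff _ _).1 (Quotient.exact hp)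
    exact ⟨_, by rw [h', col_mul_torus _ _ ht]⟩
  set j := i + 2
  set k := i + 1
  have hjk : j ≠ k := by simp [j, k]
  -- the gauge factor of the column `k`, written so that it is visibly smooth
  set t : ℂ → ℂ := fun y => ∑ b, star (col (e y) k b) * col (e' y) k b
  have hcolk : ∀ y ∈ V, ∀ a, col (e' y) k a = t y * col (e y) k a := fun y hy a => by
    obtain ⟨c, hc⟩ := hcol y hy k
    have : t y = c := by
      have := sum_star_col_mul_col (e y) k k
      simp only [t, hc, Pi.smul_apply, smul_eq_mul, mul_left_comm _ c, ← Finset.mul_sum, this]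
      simp
    rw [this, hc]; rfl
  have ht : HasFDerivAt t (fderiv ℝ t z) z :=
    (HasFDerivAt.fun_sum (u := Finset.univ) fun a _ => (he.hasFDerivAt_star hz k a).mul
      (he'.hasFDerivAt hz k a)).differentiableAt.hasFDerivAt
  have hd : ∀ a, dcol e' z v k a = t z * dcol e z v k a + fderiv ℝ t z v * col (e z) k a := by
    intro a
    have hev : (fun y => col (e' y) k a) =ᶠ[nhds z] t * fun y => col (e y) k a := by
      filter_upwards [he.isOpen.mem_nhds hz] with y hy using hcolk y hy a
    rw [dcol_eq_fderiv, hev.fderiv_eq, (ht.mul (he.hasFDerivAt hz k a)).fderiv, dcol_eq_fderiv]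
    simp [mul_comm]
  obtain ⟨c, hc⟩ := hcol z hz j
  rw [eta_apply, maurerCartan_apply] at h ⊢
  have h1 := sum_star_col_mul_col (e z) j k
  rw [if_neg hjk] at h1
  have : ∑ a, star (col (e' z) j a) * dcol e' z v k a
      = star c * (t z * (∑ a, star (col (e z) j a) * dcol e z v k a)
        + fderiv ℝ t z v * ∑ a, star (col (e z) j a) * col (e z) k a) := by
    simp only [hd, hc, Finset.mul_sum, ← Finset.sum_add_distrib, Pi.smul_apply, smul_eq_mul,
      star_mul']
    exact Finset.sum_congr rfl fun a _ => by ring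
  rw [this, h, h1]
  simp

end PlaneDomain

section Surface

open Complex

variable {S : Type*} [TopologicalSpace S] [ChartedSpace ℂ S] {f : S → Flag} {U U' : Set S}
  {e e' : S → SU3}

theorem IsLocalFrame.mono (he : IsLocalFrame f U e) (hU' : IsOpen U') (h : U' ⊆ U) :
    IsLocalFrame f U' e :=
  ⟨hU', fun j a => (he.smooth j a).mono h, fun q hq => he.lift q (h hq)⟩

variable [IsManifold 𝓘(ℂ) ω S]

theorem IsLocalFrame.star_maurerCartan (he : IsLocalFrame f U e) {p : S} (hp : p ∈ U)
    (v : ℂ) (j k : Fin 3) : star (maurerCartan e p v j k) = -maurerCartan e p v k j := by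
  obtain ⟨c, -, h⟩ := exists_maurerCartan_chart p (mem_chart_source ℂ p)
  rw [h f U e he hp v]
  refine (he.comp_chart_symm p).star_maurerCartan_plane
    ⟨mem_chart_target ℂ p, ?_⟩ _ j k
  simpa using hp

/-- The vanishing of `η_i` at a point does not depend on the lift. -/
theorem IsLocalFrame.eta_eq_zero (he : IsLocalFrame f U e) (he' : IsLocalFrame f U' e')
    {p : S} (hp : p ∈ U) (hp' : p ∈ U') {v : ℂ} {i : Fin 3} (h : eta e p v i = 0) :
    eta e' p v i = 0 := by
  obtain ⟨c, -, hc⟩ := exists_maurerCartan_chart p (mem_chart_source ℂ p)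
  have hU := he.isOpen.inter he'.isOpen
  have h1 := (he.mono hU Set.inter_subset_left).comp_chart_symm p
  have h2 := (he'.mono hU Set.inter_subset_right).comp_chart_symm p
  rw [eta_apply, hc f U e he hp, ← eta_apply] at h
  rw [eta_apply, hc f U' e' he' hp', ← eta_apply]
  refine h1.eta_eq_zero_plane h2 ⟨mem_chart_target ℂ p, ?_⟩ h
  simpa using ⟨hp, hp'⟩

end Surface

/-! ### The vanishing loci of the forms `η_i` -/

section VanishingLoci

open Complex

variable {S : Type*} [TopologicalSpace S] [ChartedSpace ℂ S] {f : S → Flag} {U : Set S}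
  {e : S → SU3}

theorem maurerCartan_add_mul_I (e : S → SU3) (p : S) (x y : ℝ) (j k : Fin 3) :
    maurerCartan e p (x + y * I) j k = x * maurerCartan e p 1 j k + y * maurerCartan e p I j k := by
  have hd : ∀ a, dcol e p (x + y * I) k a = x * dcol e p 1 k a + y * dcol e p I k a := fun a => by
    have hv : ((x : ℂ) + y * I) = x • (1 : ℂ) + y • I := by simp
    rw [hv]
    set L : ℂ →L[ℝ] ℂ := mfderiv 𝓘(ℝ, ℂ) 𝓘(ℝ, ℂ) (fun q => col (e q) k a) p
    change L (x • (1 : ℂ) + y • I) = x * L 1 + y * L I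
    rw [map_add, map_smul, map_smul, real_smul, real_smul]
  simp only [maurerCartan_apply, hd, Finset.mul_sum, ← Finset.sum_add_distrib]
  exact Finset.sum_congr rfl fun a _ => by ring

/-- A form of type `(1,0)` at `p` is determined by its value at the tangent vector `1`. -/
theorem eta_eq_mul {p : S} {i : Fin 3} (h : eta e p (I * 1) i = I * eta e p 1 i) (v : ℂ) :
    eta e p v i = v * eta e p 1 i := by
  rw [mul_one] at h
  simp only [eta_apply] at h ⊢
  conv_lhs => rw [← re_add_im v]
  rw [maurerCartan_add_mul_I, h]
  conv_rhs => rw [← re_add_im v]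
  ring

theorem IsLocalFrame.of_comp_cyc {i : Fin 3} (he : IsLocalFrame (fun q => cyc i (f q)) U e) :
    IsLocalFrame f U (fun q => cycFrame (-i) (e q)) := by
  simpa only [cyc_cyc, neg_add_cancel, cyc_zero] using he.comp_cyc (-i)

theorem IsSmooth.comp_cyc (hf : IsSmooth f) (i : Fin 3) :
    IsSmooth fun q => cyc i (f q) := fun p => by
  obtain ⟨U, e, hp, he⟩ := hf p
  exact ⟨U, _, hp, he.comp_cyc i⟩

/-- The cyclic permutation of flags permutes the `η_i`, so it preserves pseudo-holomorphic
curves. -/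
theorem IsJHolomorphicCurve.comp_cyc (hf : IsJHolomorphicCurve f) (i : Fin 3) :
    IsJHolomorphicCurve fun q => cyc i (f q) where
  smooth := hf.smooth.comp_cyc i
  holo U e he p hp v j := by
    have := hf.holo U _ he.of_comp_cyc p hp v (j + i)
    simpa only [eta_cycFrame, add_neg_cancel_right] using this
  immersed U e he p hp v h := by
    refine hf.immersed U _ he.of_comp_cyc p hp v ?_
    funext j
    rw [eta_cycFrame, h]; rfl

/-- The set of points near which the form `η_{i+1}` of `f` vanishes identically. -/
def etaZeroSet (f : S → Flag) (i : Fin 3) : Set S :=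
  {p | ∃ U e, p ∈ U ∧ IsLocalFrame f U e ∧ ∀ q ∈ U, ∀ v, eta e q v i = 0}

theorem isOpen_etaZeroSet (f : S → Flag) (i : Fin 3) : IsOpen (etaZeroSet f i) := by
  refine isOpen_iff_mem_nhds.2 fun p ⟨U, e, hp, he, h⟩ => ?_
  filter_upwards [he.isOpen.mem_nhds hp] with q hq using ⟨U, e, hq, he, h⟩

theorem etaZeroSet_cyc (f : S → Flag) (i s : Fin 3) :
    etaZeroSet (fun q => cyc s (f q)) i = etaZeroSet f (i + s) := by
  ext p
  constructor
  · rintro ⟨U, e, hp, he, h⟩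
    refine ⟨U, _, hp, he.of_comp_cyc, fun q hq v => ?_⟩
    rw [eta_cycFrame, add_neg_cancel_right, h q hq v]
  · rintro ⟨U, e, hp, he, h⟩
    refine ⟨U, _, hp, he.comp_cyc s, fun q hq v => ?_⟩
    rw [eta_cycFrame, h q hq v]

variable [IsManifold 𝓘(ℂ) ω S]

theorem eta_eq_zero_of_mem_etaZeroSet {p : S} {i : Fin 3} (hpi : p ∈ etaZeroSet f i)
    (he : IsLocalFrame f U e) (hp : p ∈ U) (v : ℂ) : eta e p v i = 0 := by
  obtain ⟨U', e', hp', he', h⟩ := hpi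
  exact he'.eta_eq_zero he hp' hp (h p hp' v)

theorem exists_eta_chart (p₀ : S) {p : S} (hp : p ∈ (chartAt ℂ p₀).source) :
    ∃ c : ℂ, c ≠ 0 ∧ ∀ (f : S → Flag) (U : Set S) (e : S → SU3), IsLocalFrame f U e → p ∈ U →
      ∀ v i, eta e p v i = eta (e ∘ (chartAt ℂ p₀).symm) (chartAt ℂ p₀ p) (c * v) i := by
  obtain ⟨c, hc, h⟩ := exists_maurerCartan_chart p₀ hp
  refine ⟨c, hc, fun f U e he hpU v i => ?_⟩
  rw [eta_apply, h f U e he hpU, eta_apply]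

theorem IsJHolomorphicCurve.eta_chart (hf : IsJHolomorphicCurve f) (he : IsLocalFrame f U e)
    (p₀ : S) {z : ℂ} (hz : z ∈ (chartAt ℂ p₀).target ∩ (chartAt ℂ p₀).symm ⁻¹' U) (v : ℂ)
    (i : Fin 3) :
    eta (e ∘ (chartAt ℂ p₀).symm) z (I * v) i = I * eta (e ∘ (chartAt ℂ p₀).symm) z v i := by
  obtain ⟨c, hc, h⟩ := exists_eta_chart p₀ ((chartAt ℂ p₀).map_target hz.1)
  have h1 := h f U e he hz.2 (I * (c⁻¹ * v)) i
  have h2 := h f U e he hz.2 (c⁻¹ * v) i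
  rw [(chartAt ℂ p₀).right_inv hz.1] at h1 h2
  have e1 : c * (I * (c⁻¹ * v)) = I * v := by field_simp
  rw [hf.holo U e he _ hz.2, h2, mul_inv_cancel_left₀ hc, e1] at h1
  exact h1.symm

theorem IsJHolomorphicCurve.eta_eq_zero_iff_chart (hf : IsJHolomorphicCurve f)
    (he : IsLocalFrame f U e) (p₀ : S) {p : S} (hp₀ : p ∈ (chartAt ℂ p₀).source) (hp : p ∈ U)
    (i : Fin 3) :
    (∀ v, eta e p v i = 0) ↔ eta (e ∘ (chartAt ℂ p₀).symm) (chartAt ℂ p₀ p) 1 i = 0 := by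
  obtain ⟨c, hc, h⟩ := exists_eta_chart p₀ hp₀
  have hz : chartAt ℂ p₀ p ∈ (chartAt ℂ p₀).target ∩ (chartAt ℂ p₀).symm ⁻¹' U :=
    ⟨(chartAt ℂ p₀).map_source hp₀, by simpa [(chartAt ℂ p₀).left_inv hp₀] using hp⟩
  constructor
  · intro h0
    have := h f U e he hp c⁻¹ i
    rwa [h0, mul_inv_cancel₀ hc, eq_comm] at this
  · intro h0 v
    rw [h f U e he hp, eta_eq_mul (hf.eta_chart he p₀ hz 1 i), h0, mul_zero]

/-- By unique continuation, the vanishing locus of `η₃` is closed. -/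
theorem IsJHolomorphicCurve.isClosed_etaZeroSet_two (hf : IsJHolomorphicCurve f) :
    IsClosed (etaZeroSet f 2) := by
  refine isClosed_of_closure_subset fun p hp => ?_
  obtain ⟨U, e, hpU, he⟩ := hf.smooth p
  set φ := chartAt ℂ p
  have hE := he.comp_chart_symm p
  set V := φ.target ∩ φ.symm ⁻¹' U
  have hps : p ∈ φ.source := mem_chart_source ℂ p
  have hpV : φ p ∈ V := ⟨φ.map_source hps, by simpa [φ.left_inv hps] using hpU⟩
  obtain ⟨β, hβ, hdbar⟩ := hE.dbar_eta fun z hz v i => hf.eta_chart he p hz v i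
  obtain ⟨r, hr, hrV⟩ := Metric.nhds_basis_closedBall.mem_iff.1 (hE.isOpen.mem_nhds hpV)
  have hNo : IsOpen (φ.source ∩ φ ⁻¹' Metric.ball (φ p) r) :=
    φ.isOpen_inter_preimage Metric.isOpen_ball
  obtain ⟨q, ⟨hqs, hqr⟩, U', e', hqU', he', h'⟩ :=
    mem_closure_iff.1 hp _ hNo ⟨hps, Metric.mem_ball_self hr⟩
  have hA : DifferentiableOn ℝ (fun y => eta (e ∘ φ.symm) y 1 2) V :=
    (hE.contDiffOn_maurerCartan 1 1 0).differentiableOn (by simp)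
  have hV' := (he'.comp_chart_symm p).isOpen
  have h0 : (fun y => eta (e ∘ φ.symm) y 1 2) =ᶠ[nhds (φ q)] 0 := by
    have hqV : φ q ∈ V := hrV (Metric.ball_subset_closedBall hqr)
    filter_upwards [hE.isOpen.mem_nhds hqV,
      hV'.mem_nhds ⟨φ.map_source hqs, by simpa [φ, φ.left_inv hqs] using hqU'⟩] with z hz hz'
    have := (hf.eta_eq_zero_iff_chart he p (φ.map_target hz.1) hz.2 2).1 fun v =>
      he'.eta_eq_zero he hz'.2 hz.2 (h' _ hz'.2 v)
    rwa [φ.right_inv hz.1] at this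
  have hzero := eqOn_zero_of_dbar_eq_mul hE.isOpen hA hβ hdbar hr hrV hqr h0
  have hsub : ∀ x ∈ φ.source ∩ φ ⁻¹' Metric.ball (φ p) r, x ∈ U := fun x hx => by
    have := (hrV (Metric.ball_subset_closedBall hx.2)).2
    rwa [Set.mem_preimage, φ.left_inv hx.1] at this
  refine ⟨φ.source ∩ φ ⁻¹' Metric.ball (φ p) r, e, ⟨hps, Metric.mem_ball_self hr⟩,
    he.mono hNo hsub, fun x hx => ?_⟩
  exact (hf.eta_eq_zero_iff_chart he p hx.1 (hsub x hx) 2).2 (hzero hx.2)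

theorem IsJHolomorphicCurve.isClopen_etaZeroSet (hf : IsJHolomorphicCurve f) (i : Fin 3) :
    IsClopen (etaZeroSet f i) := by
  refine ⟨?_, isOpen_etaZeroSet f i⟩
  have := (hf.comp_cyc (i - 2)).isClosed_etaZeroSet_two
  rwa [etaZeroSet_cyc, add_sub_cancel] at this

/-- If the cubic form vanishes, then one of its three factors vanishes on a non-empty open set. -/
theorem IsSuperholomorphic.exists_etaZeroSet_nonempty [Nonempty S] (hf : IsSuperholomorphic f) :
    ∃ i, (etaZeroSet f i).Nonempty := by
  have hJ := hf.toIsJHolomorphicCurve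
  obtain ⟨p⟩ := ‹Nonempty S›
  obtain ⟨U, e, hpU, he⟩ := hJ.smooth p
  set φ := chartAt ℂ p
  have hE := he.comp_chart_symm p
  set V := φ.target ∩ φ.symm ⁻¹' U
  have hps : p ∈ φ.source := mem_chart_source ℂ p
  have hpV : φ p ∈ V := ⟨φ.map_source hps, by simpa [φ.left_inv hps] using hpU⟩
  set A : Fin 3 → ℂ → ℂ := fun i y => eta (e ∘ φ.symm) y 1 i
  have hA : ∀ i, ContinuousOn (A i) V := fun i => by
    simp only [A, eta_apply]
    exact (hE.contDiffOn_maurerCartan 1 _ _).continuousOn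
  have hprod : ∀ z ∈ V, A 0 z * A 1 z * A 2 z = 0 := fun z hz => by
    obtain ⟨c, hc, h⟩ := exists_eta_chart p (φ.map_target hz.1)
    have h' := fun i => h f U e he hz.2 c⁻¹ i
    simp only [φ.right_inv hz.1, φ, mul_inv_cancel₀ hc] at h'
    have := hf.cubic_eq_zero U e he _ hz.2 c⁻¹
    rwa [cubicForm, h', h', h'] at this
  -- an open set on which a factor vanishes gives a point of the corresponding locus
  have key : ∀ i, ∀ W ⊆ V, IsOpen W → W.Nonempty → (∀ z ∈ W, A i z = 0) →
      (etaZeroSet f i).Nonempty := by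
    rintro i W hWV hW ⟨z, hz⟩ h0
    have hmem : ∀ x ∈ φ.source ∩ φ ⁻¹' W, x ∈ U := fun x hx => by
      have := (hWV hx.2).2
      rwa [Set.mem_preimage, φ.left_inv hx.1] at this
    refine ⟨φ.symm z, φ.source ∩ φ ⁻¹' W, e, ⟨φ.map_target (hWV hz).1, ?_⟩,
      he.mono (φ.isOpen_inter_preimage hW) hmem, fun x hx =>
      (hJ.eta_eq_zero_iff_chart he p hx.1 (hmem x hx) i).2 (h0 _ hx.2)⟩
    rwa [Set.mem_preimage, φ.right_inv (hWV hz).1]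
  by_contra! hne
  have hstep : ∀ i, ∀ W ⊆ V, IsOpen W → W.Nonempty →
      IsOpen (W ∩ A i ⁻¹' {0}ᶜ) ∧ (W ∩ A i ⁻¹' {0}ᶜ).Nonempty := by
    intro i W hWV hW hWn
    refine ⟨((hA i).mono hWV).isOpen_inter_preimage hW isOpen_compl_singleton, ?_⟩
    by_contra hemp
    refine (key i W hWV hW hWn fun z hz => ?_).ne_empty (hne i)
    by_contra hz0
    exact hemp ⟨z, hz, hz0⟩
  obtain ⟨o0, n0⟩ := hstep 0 V subset_rfl hE.isOpen ⟨_, hpV⟩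
  obtain ⟨o1, n1⟩ := hstep 1 _ Set.inter_subset_left o0 n0
  obtain ⟨-, z, ⟨⟨hzV, hz0⟩, hz1⟩, hz2⟩ := hstep 2 _
    (Set.inter_subset_left.trans Set.inter_subset_left) o1 n1
  exact mul_ne_zero (mul_ne_zero hz0 hz1) hz2 (hprod z hzV)

/-- The cyclic position of a factor of the cubic form that vanishes identically and is followed by
one that vanishes on no open set. An immersion does not have all three factors zero. -/
theorem IsSuperholomorphic.exists_etaZeroSet_eq [ConnectedSpace S] (hf : IsSuperholomorphic f) :
    ∃ i : Fin 3, etaZeroSet f (1 + i) = Set.univ ∧ etaZeroSet f (2 + i) = ∅ := by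
  have hJ := hf.toIsJHolomorphicCurve
  have hdich := fun i => isClopen_iff.1 (hJ.isClopen_etaZeroSet i)
  obtain ⟨j, hj⟩ := hf.exists_etaZeroSet_nonempty
  have hj' := (hdich j).resolve_left hj.ne_empty
  have hnot : ¬ ∀ i, etaZeroSet f i = Set.univ := by
    intro hall
    obtain ⟨p⟩ := (inferInstance : Nonempty S)
    obtain ⟨U, e, hp, he⟩ := hJ.smooth p
    refine one_ne_zero (α := ℂ) (hJ.immersed U e he p hp 1 (funext fun i => ?_))
    exact eta_eq_zero_of_mem_etaZeroSet (hall i ▸ Set.mem_univ p) he hp 1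
  by_contra! hcon
  have hnext : ∀ i, etaZeroSet f i = Set.univ → etaZeroSet f (i + 1) = Set.univ := fun i hi => by
    have h := hcon (i - 1)
    have h2 : ∀ i : Fin 3, 2 + (i - 1) = i + 1 := by decide
    rw [add_sub_cancel, h2] at h
    exact (hdich _).resolve_left (h hi).ne_empty
  refine hnot fun i => ?_
  have h1 := hnext _ hj'
  have h2 := hnext _ h1
  obtain h | h | h : i = j ∨ i = j + 1 ∨ i = j + 1 + 1 := by omega
  all_goals rw [h]; assumption

end VanishingLoci

/-! ### Frenet frames from a vanishing form -/

section Frenet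

open Complex

variable {S : Type*} [TopologicalSpace S] [ChartedSpace ℂ S] [IsManifold 𝓘(ℂ) ω S] {F : S → Flag}

/-- Where `η₂` vanishes, the derivative of `e₁` has no component along `e₃`. -/
theorem dcol_zero_eq {U : Set S} {e : S → SU3} (he : IsLocalFrame F U e) {p : S} (hp : p ∈ U)
    (h1 : p ∈ etaZeroSet F 1) (v : ℂ) (a : Fin 3) :
    dcol e p v 0 a
      = maurerCartan e p v 0 0 * col (e p) 0 a + maurerCartan e p v 1 0 * col (e p) 1 a := by
  have h := eta_eq_zero_of_mem_etaZeroSet h1 he hp v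
  have h20 : maurerCartan e p v 2 0 = 0 := by
    have hs := he.star_maurerCartan hp v 0 2
    rw [show maurerCartan e p v 0 2 = 0 from h, star_zero] at hs
    exact neg_eq_zero.1 hs.symm
  rw [dcol_eq_sum, Fin.sum_univ_three, h20, zero_mul, add_zero]

theorem isFrenetFrame_tau (hF : IsSmooth F) (h1 : etaZeroSet F 1 = Set.univ) :
    IsFrenetFrame (fun p => tau 0 (F p)) F where
  smooth := hF
  line _ := rfl
  tangent U e he p hp v := by
    refine Submodule.mem_span_pair.2
      ⟨maurerCartan e p v 0 0, maurerCartan e p v 1 0, funext fun a => ?_⟩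
    exact (dcol_zero_eq he hp (h1 ▸ Set.mem_univ p) v a).symm

/-- A quotient of two components of `e₁` is holomorphic, as `∂e₁/∂z̄` is a multiple of `e₁`. -/
theorem mdifferentiableAt_col_div (hF : IsJHolomorphicCurve F) {U : Set S} {e : S → SU3}
    (he : IsLocalFrame F U e) (h1 : etaZeroSet F 1 = Set.univ) {p : S} (hp : p ∈ U) {a : Fin 3}
    (ha : col (e p) 0 a ≠ 0) :
    MDifferentiableAt 𝓘(ℂ) 𝓘(ℂ, Fin 3 → ℂ) (fun q b => col (e q) 0 b / col (e q) 0 a) p := by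
  have : IsManifold 𝓘(ℂ) 1 S := IsManifold.of_le (n := ω) (by simp)
  set φ := chartAt ℂ p
  have hps : p ∈ φ.source := mem_chart_source ℂ p
  have hE := he.comp_chart_symm p
  set E := e ∘ φ.symm
  have hEp : E (φ p) = e p := by simp [E, φ.left_inv hps]
  have hz : φ p ∈ φ.target ∩ φ.symm ⁻¹' U :=
    ⟨φ.map_source hps, by simpa [φ.left_inv hps] using hp⟩
  obtain ⟨c, hc, hd⟩ := exists_dcol_chart p hps
  have hdE : ∀ w b, fderiv ℝ (fun y => col (E y) 0 b) (φ p) w =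
      maurerCartan e p (c⁻¹ * w) 0 0 * col (e p) 0 b
        + maurerCartan e p (c⁻¹ * w) 1 0 * col (e p) 1 b := fun w b => by
    rw [← dcol_zero_eq he hp (h1 ▸ Set.mem_univ p), hd F U e he hp, mul_inv_cancel_left₀ hc,
      dcol_eq_fderiv]
  have hane : col (E (φ p)) 0 a ≠ 0 := by rwa [hEp]
  have hcol := fun b => (hE.hasFDerivAt hz 0 b).differentiableAt
  have hdiff : DifferentiableAt ℂ (fun y b => col (E y) 0 b / col (E y) 0 a) (φ p) := by
    refine differentiableAt_pi.2 fun b => ?_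
    set Q : ℂ → ℂ := fun y => col (E y) 0 b / col (E y) 0 a
    have hQ : DifferentiableAt ℝ Q (φ p) := by
      simp only [Q, div_eq_mul_inv]
      exact (hcol b).mul ((hcol a).inv hane)
    refine differentiableAt_complex_iff_differentiableAt_real.2 ⟨hQ, ?_⟩
    -- differentiating `Q · e₁ᵃ = e₁ᵇ` gives `e₁ᵃ dQ = η₃ · (e₂ᵇ - Q e₂ᵃ)`
    have hev : (fun y => col (E y) 0 b) =ᶠ[nhds (φ p)] Q * fun y => col (E y) 0 a := by
      filter_upwards [(hcol a).continuousAt.eventually_ne hane] with y hy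
      simp [Q, div_mul_cancel₀ _ hy]
    have hfd := hev.fderiv_eq.trans (hQ.hasFDerivAt.mul (hcol a).hasFDerivAt).fderiv
    have h := fun w => congrArg (fun L : ℂ →L[ℝ] ℂ => L w) hfd
    simp only [hdE, _root_.add_apply, _root_.smul_apply, smul_eq_mul, hEp] at h
    have hQp : Q (φ p) * col (e p) 0 a = col (e p) 0 b := by
      simp only [Q, hEp]
      exact div_mul_cancel₀ _ ha
    have hη : maurerCartan e p (c⁻¹ * I) 1 0 = I * maurerCartan e p (c⁻¹ * 1) 1 0 := by
      have := hF.holo U e he p hp (c⁻¹ * 1) 2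
      rwa [mul_left_comm, mul_one I] at this
    have hI := h I
    rw [hη] at hI
    refine mul_left_cancel₀ ha ?_
    rw [smul_eq_mul]
    linear_combination I * h 1 - hI +
      (maurerCartan e p (c⁻¹ * I) 0 0 - I * maurerCartan e p (c⁻¹ * 1) 0 0) * -hQp
  have hcomp := MDifferentiableAt.comp (I' := 𝓘(ℂ)) p hdiff.mdifferentiableAt
    ((mdifferentiable_chart (I := 𝓘(ℂ)) p).mdifferentiableAt hps)
  refine hcomp.congr_of_eventuallyEq ?_
  filter_upwards [φ.open_source.mem_nhds hps] with q hq
  simp [E, φ.left_inv hq]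

/-- If the line spanned by `e₁` is constant, then `⟨e₁, e₂(z)⟩` vanishes identically, hence so does
its derivative at `z`, which is `η₃`. -/
theorem IsLocalFrame.eta_two_eq_zero_of_line {f : ℂ → Flag} {V : Set ℂ} {e : ℂ → SU3}
    (he : IsLocalFrame f V e) {z : ℂ} (hz : z ∈ V)
    (hline : ∀ y ∈ V, ∃ c : ℂ, col (e y) 0 = c • col (e z) 0) (v : ℂ) : eta e z v 2 = 0 := by
  have hs := HasFDerivAt.fun_sum (u := Finset.univ) fun a _ =>
    (he.hasFDerivAt hz 0 a).const_mul (star (col (e z) 1 a))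
  have hev : (fun y => ∑ a, star (col (e z) 1 a) * col (e y) 0 a) =ᶠ[nhds z] fun _ => 0 := by
    filter_upwards [he.isOpen.mem_nhds hz] with y hy
    obtain ⟨c, hc⟩ := hline y hy
    have := sum_star_col_mul_col (e z) 1 0
    rw [if_neg (by decide)] at this
    simp only [hc, Pi.smul_apply, smul_eq_mul, mul_left_comm _ c, ← Finset.mul_sum, this, mul_zero]
  have h0 := congrArg (fun L : ℂ →L[ℝ] ℂ => L v)
    (hs.unique ((hasFDerivAt_const (0 : ℂ) z).congr_of_eventuallyEq hev))
  simp only [_root_.sum_apply, _root_.smul_apply, smul_eq_mul, ← dcol_eq_fderiv] at h0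
  exact h0

theorem tau_proj (j : Fin 3) (g : SU3) :
    tau j (proj g) = Projectivization.mk ℂ (col g j) (col_ne_zero g j) := rfl

/-- A curve whose `η₂` vanishes and whose `η₃` does not has a non-constant holomorphic projection
`span e₁` to `ℂP²`. -/
theorem isHolomorphicCurve_tau [Nonempty S] (hF : IsJHolomorphicCurve F)
    (h1 : etaZeroSet F 1 = Set.univ) (h2 : etaZeroSet F 2 = ∅) :
    IsHolomorphicCurve fun p => tau 0 (F p) where
  holo p := by
    obtain ⟨U, e, hp, he⟩ := hF.smooth p
    obtain ⟨a, ha⟩ := Function.ne_iff.1 (col_ne_zero (e p) 0)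
    have hopen : IsOpen (U ∩ (fun q => col (e q) 0 a) ⁻¹' {0}ᶜ) :=
      (he.smooth 0 a).continuousOn.isOpen_inter_preimage he.isOpen isOpen_compl_singleton
    refine ⟨_, fun q b => col (e q) 0 b / col (e q) 0 a, hopen, ⟨hp, ha⟩, fun q hq => ?_,
      fun q hq => ?_⟩
    · exact (mdifferentiableAt_col_div hF he h1 hq.1 hq.2).mdifferentiableWithinAt
    · have hq0 : col (e q) 0 a ≠ 0 := hq.2
      refine ⟨fun h0 => ?_, ?_⟩
      · have := congrFun h0 a
        simp [div_self hq0] at this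
      · rw [← he.lift q hq.1, tau_proj, Projectivization.mk_eq_mk_iff']
        refine ⟨col (e q) 0 a, funext fun b => ?_⟩
        simp [mul_div_cancel₀ _ hq0]
  nonconstant := by
    -- if `span e₁` is constant, then `de₁` is orthogonal to `e₂`, so `η₃` vanishes
    by_contra! hconst
    obtain ⟨p⟩ := ‹Nonempty S›
    obtain ⟨U, e, hp, he⟩ := hF.smooth p
    have hmem : p ∈ etaZeroSet F 2 := by
      refine ⟨U, e, hp, he, fun q hq v => ?_⟩
      have hline : ∀ y ∈ U, ∃ c : ℂ, col (e y) 0 = c • col (e q) 0 := fun y hy => by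
        have := hconst y q
        rw [← he.lift y hy, ← he.lift q hq, tau_proj, tau_proj,
          Projectivization.mk_eq_mk_iff'] at this
        obtain ⟨c, hc⟩ := this
        exact ⟨c, hc.symm⟩
      obtain ⟨c, -, hc⟩ := exists_eta_chart q (mem_chart_source ℂ q)
      rw [hc F U e he hq]
      refine (he.comp_chart_symm q).eta_two_eq_zero_of_line
        ⟨mem_chart_target ℂ q, by simpa using hq⟩ (fun y hy => ?_) _
      simpa using hline _ hy.2
    exact absurd hmem (h2 ▸ Set.notMem_empty p)

end Frenet

end FlagCurves

theorem theorem5p5 {S : Type*} [TopologicalSpace S] [T2Space S] [ConnectedSpace S]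
    [ChartedSpace ℂ S] [IsManifold 𝓘(ℂ) ω S]
    (f : S → FlagCurves.Flag) (hf : FlagCurves.IsSuperholomorphic f) :
    ∃ (h : S → FlagCurves.CP2) (F : S → FlagCurves.Flag) (i : Fin 3),
      FlagCurves.IsHolomorphicCurve h ∧ FlagCurves.IsFrenetFrame h F ∧
        f = FlagCurves.frenetLift i F := by
  obtain ⟨i, h1, h2⟩ := hf.exists_etaZeroSet_eq
  rw [← FlagCurves.etaZeroSet_cyc] at h1 h2
  have hF := hf.toIsJHolomorphicCurve.comp_cyc i
  refine ⟨_, _, -i, FlagCurves.isHolomorphicCurve_tau hF h1 h2,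
    FlagCurves.isFrenetFrame_tau hF.smooth h1, funext fun p => ?_⟩
  rw [FlagCurves.frenetLift, FlagCurves.cyc_cyc, neg_add_cancel, FlagCurves.cyc_zero]
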